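/- Let $A$ and $B$ be complex elliptic curves (compact connected complex Lie groups of dimension one), and suppose that they are isogenous, i.e. that there is an isogeny (a surjective holomorphic group homomorphism with finite kernel) from one of them to the other. Let $\operatorname{Hom}(B,A)$ be the $\mathbb{Z}$-module of holomorphic group homomorphisms $B\to A$. Suppose that the $j$-invariant of $B$ is $0$ or $1728$, and put $n=3$ if $j(B)=0$ and $n=4$ if $j(B)=1728$. (Here $j(B)=1728\,g_2^3/(g_2^3-27g_3^2)$ for a lattice $\Lambda\subset\mathbb{C}$ with $B\cong\mathbb{C}/\Lambda$, that is, $j(B)$ is the $j$-invariant of the Weierstrass curve $y^2=x^3-\tfrac{g_2}{4}x-\tfrac{g_3}{4}$ of $\Lambda$, where $g_2=60\sum_{0\ne\ell\in\Lambda}\ell^{-4}$ and $g_3=140\sum_{0\ne\ell\in\Lambda}\ell^{-6}$.) Then $B$ has an automorphism (a holomorphic group automorphism) of order $n$. Moreover, for every automorphism $\lambda_B$ of $B$ of order $n$ there is an isogeny $\psi\colon B\to A$ such that $$\operatorname{Hom}(B,A)=\langle \psi,\ \psi\circ\lambda_B\rangle ,$$ that is, $\operatorname{Hom}(B,A)$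 is generated as a $\mathbb{Z}$-module by $\psi$ and $\psi\circ\lambda_B$. -/

import Mathlib

open Filter Topology
open scoped Manifold ContDiff

namespace PeriodPair

theorem isConnected_compl_lattice' (L : PeriodPair) : IsPreconnected (L.lattice : Set ℂ)ᶜ := by
  have hc : (L.lattice : Set ℂ).Countable := by
    have : Countable L.lattice := L.latticeEquivProd.toEquiv.countable_iff.mpr inferInstance
    exact Set.countable_coe_iff.mp this
  exact (hc.isPathConnected_compl_of_one_lt_rank (by simp)).isConnected.isPreconnected

theorem hasDerivAt_weierstrassP' (L : PeriodPair) {z : ℂ} (hz : z ∉ L.lattice) :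
    HasDerivAt L.weierstrassP (L.derivWeierstrassP z) z := by
  have h := (L.analyticOnNhd_weierstrassP z hz).differentiableAt.hasDerivAt
  rwa [L.deriv_weierstrassP] at h

theorem derivWeierstrassP_not_zero (L : PeriodPair) :
    ∃ z, z ∉ L.lattice ∧ L.derivWeierstrassP z ≠ 0 := by
  by_contra! H
  have hroot : ∀ z, z ∉ L.lattice →
      4 * L.weierstrassP z ^ 3 - L.g₂ * L.weierstrassP z - L.g₃ = 0 := fun z hz => by
    rw [← L.derivWeierstrassP_sq z hz, H z hz]; simp
  have hz0 := L.ω₁_div_two_notMem_lattice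
  have hconst : ∀ z, z ∉ L.lattice → L.weierstrassP z = L.weierstrassP (L.ω₁ / 2) := by
    intro z hz
    refine L.isClosed_lattice.isOpen_compl.is_const_of_deriv_eq_zero
      (L.isConnected_compl_lattice') L.differentiableOn_weierstrassP ?_ hz hz0
    intro w hw
    rw [L.deriv_weierstrassP]; exact H w hw
  have hev : ∀ᶠ z in 𝓝[≠] (0 : ℂ), z ∉ L.lattice := by
    have := L.compl_lattice_sdiff_singleton_mem_nhds 0
    filter_upwards [nhdsWithin_le_nhds this, self_mem_nhdsWithin] with z hz hz' hl
    exact hz ⟨hl, hz'⟩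
  have hcongr : L.weierstrassP =ᶠ[𝓝[≠] (0 : ℂ)] fun _ => L.weierstrassP (L.ω₁ / 2) := by
    filter_upwards [hev] with z hz using hconst z hz
  have h1 := L.order_weierstrassP 0 (zero_mem _)
  rw [meromorphicOrderAt_congr hcongr] at h1
  have h2 : (0 : WithTop ℤ) ≤ meromorphicOrderAt (fun _ : ℂ => L.weierstrassP (L.ω₁ / 2)) 0 :=
    analyticAt_const.meromorphicOrderAt_nonneg
  rw [h1] at h2
  exact absurd h2 (by decide)

theorem hasDerivAt_derivWeierstrassP (L : PeriodPair) {z : ℂ} (hz : z ∉ L.lattice) :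
    HasDerivAt L.derivWeierstrassP (6 * L.weierstrassP z ^ 2 - L.g₂ / 2) z := by
  have hA := L.analyticOnNhd_derivWeierstrassP
  have hB : AnalyticOnNhd ℂ (fun w => deriv L.derivWeierstrassP w
      - (6 * L.weierstrassP w ^ 2 - L.g₂ / 2)) (L.lattice : Set ℂ)ᶜ :=
    hA.deriv.sub ((analyticOnNhd_const.mul (L.analyticOnNhd_weierstrassP.pow 2)).sub
      analyticOnNhd_const)
  have key : ∀ w ∈ (L.lattice : Set ℂ)ᶜ, L.derivWeierstrassP w • (deriv L.derivWeierstrassP w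
      - (6 * L.weierstrassP w ^ 2 - L.g₂ / 2)) = 0 := by
    intro w hw
    have d1 := ((hA w hw).differentiableAt.hasDerivAt).pow 2
    have d0 := L.hasDerivAt_weierstrassP' hw
    have d2 := (((d0.pow 3).const_mul 4).sub (d0.const_mul L.g₂)).sub_const L.g₃
    have heq : (L.derivWeierstrassP ^ 2) =ᶠ[𝓝 w]
        (fun x => ((fun y => 4 * (L.weierstrassP ^ 3) y) - fun y => L.g₂ * L.weierstrassP y) x
          - L.g₃) := by
      filter_upwards [L.isClosed_lattice.isOpen_compl.mem_nhds hw] with x hx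
      simpa using L.derivWeierstrassP_sq x hx
    have := d1.unique (d2.congr_of_eventuallyEq heq)
    simp only [smul_eq_mul]
    norm_num at this
    linear_combination this / 2
  rcases hA.eq_zero_or_eq_zero_of_smul_eq_zero hB key L.isConnected_compl_lattice' with h | h
  · obtain ⟨w, hw, hne⟩ := L.derivWeierstrassP_not_zero
    exact absurd (h w hw) hne
  · have hd := (hA z hz).differentiableAt.hasDerivAt
    rwa [sub_eq_zero.mp (h z hz)] at hd

theorem derivWeierstrassP_half (L : PeriodPair) {h : ℂ} (h2 : 2 * h ∈ L.lattice) :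
    L.derivWeierstrassP h = 0 := by
  have e1 := L.derivWeierstrassP_neg h
  have e2 := L.derivWeierstrassP_add_coe (-h) ⟨_, h2⟩
  have : -h + 2 * h = h := by ring
  simp only [this] at e2
  rw [e1] at e2
  exact CharZero.eq_neg_self_iff.mp e2

theorem weierstrassP_half_ne (L : PeriodPair) {h k : ℂ} (hh : h ∉ L.lattice) (hk : k ∉ L.lattice)
    (h2 : 2 * h ∈ L.lattice) (k2 : 2 * k ∈ L.lattice) (hkh : k - h ∉ L.lattice) :
    L.weierstrassP h ≠ L.weierstrassP k := by
  intro heq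
  let v : ℂ × ℂ → ℂ × ℂ := fun p => (p.2, 6 * p.1 ^ 2 - L.g₂ / 2)
  have hv : ContDiffAt ℝ 1 v (L.weierstrassP h, 0) := by
    have : ContDiff ℝ 1 v := by fun_prop
    exact this.contDiffAt
  obtain ⟨K, s, hs, hK⟩ := hv.exists_lipschitzOnWith
  let F : ℂ → ℝ → ℂ × ℂ := fun a t => (L.weierstrassP (a + t), L.derivWeierstrassP (a + t))
  have aux : ∀ a, a ∉ L.lattice → 2 * a ∈ L.lattice → L.weierstrassP a = L.weierstrassP h →
      ∀ᶠ t : ℝ in 𝓝 (0 : ℝ), HasDerivAt (F a) (v (F a t)) t ∧ F a t ∈ s := by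
    intro a ha ha2 hah
    have hcont : ContinuousAt (fun t : ℝ => a + (t : ℂ)) 0 := by fun_prop
    have hder : ∀ t : ℝ, a + (t : ℂ) ∉ L.lattice → HasDerivAt (F a) (v (F a t)) t := by
      intro t ht
      have hl : HasDerivAt (fun t : ℝ => a + (t : ℂ)) 1 t := by
        simpa using (Complex.ofRealCLM.hasDerivAt (x := t)).const_add a
      have := (L.hasDerivAt_weierstrassP' ht).scomp t hl
      have h' := (L.hasDerivAt_derivWeierstrassP ht).scomp t hl
      simpa [F, v, Function.comp_def] using this.prodMk h'
    have hev : ∀ᶠ t : ℝ in 𝓝 (0 : ℝ), a + (t : ℂ) ∉ L.lattice := by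
      refine hcont.eventually (p := fun x => x ∉ L.lattice) ?_
      have h0 : (fun t : ℝ => a + (t : ℂ)) 0 = a := by simp
      rw [h0]
      exact L.isClosed_lattice.isOpen_compl.mem_nhds ha
    have hFc : ContinuousAt (F a) 0 := (hder 0 (by simpa using ha)).continuousAt
    have hF0 : F a 0 = (L.weierstrassP h, 0) := by
      simp [F, hah, L.derivWeierstrassP_half ha2]
    have hs' : ∀ᶠ t in 𝓝 (0 : ℝ), F a t ∈ s := hFc (by rwa [hF0])
    filter_upwards [hev, hs'] with t ht hts using ⟨hder t ht, hts⟩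
  have hFF : F h =ᶠ[𝓝 0] F k :=
    ODE_solution_unique_of_eventually (v := fun _ => v) (s := fun _ => s)
      (Eventually.of_forall fun _ => hK) (aux h hh h2 rfl) (aux k hk k2 heq.symm)
      (by simp [F, heq, L.derivWeierstrassP_half h2, L.derivWeierstrassP_half k2])
  let D : ℂ → ℂ := fun z => L.weierstrassP (h + z) - L.weierstrassP (k + z)
  have hmer : ∀ a : ℂ, Meromorphic (fun z => L.weierstrassP (a + z)) := by
    intro a z
    exact MeromorphicAt.comp_analyticAt (f := L.weierstrassP) (g := fun z => a + z)
      (L.meromorphic_weierstrassP (a + z)) (by fun_prop)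
  have hD : Meromorphic D := fun z => (hmer h z).sub (hmer k z)
  have hfreq : ∃ᶠ z in 𝓝[≠] (0 : ℂ), D z = 0 := by
    have ht : Tendsto (fun t : ℝ => (t : ℂ)) (𝓝[≠] 0) (𝓝[≠] 0) := by
      refine tendsto_nhdsWithin_iff.mpr ⟨?_, ?_⟩
      · exact (Complex.continuous_ofReal.tendsto' 0 0 (by simp)).mono_left nhdsWithin_le_nhds
      · filter_upwards [self_mem_nhdsWithin] with t ht
        simpa using ht
    refine ht.frequently (Eventually.frequently ?_)
    filter_upwards [nhdsWithin_le_nhds hFF] with t ht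
    have := congrArg Prod.fst ht
    simp only [D, sub_eq_zero]; exact this
  have htop0 : meromorphicOrderAt D 0 = ⊤ := by
    rw [meromorphicOrderAt_eq_top_iff]
    rcases (hD 0).eventually_eq_zero_or_eventually_ne_zero with h | h
    · exact h
    · exact absurd h hfreq
  have htop : meromorphicOrderAt D (-h) = ⊤ := by
    by_contra hne
    exact (hD.exists_meromorphicOrderAt_ne_top_iff_forall.mp ⟨-h, hne⟩) 0 htop0
  have hcongr : (fun z => L.weierstrassP (h + z)) =ᶠ[𝓝[≠] (-h)]
      fun z => L.weierstrassP (k + z) := by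
    filter_upwards [meromorphicOrderAt_eq_top_iff.mp htop] with z hz using sub_eq_zero.mp hz
  have han : AnalyticAt ℂ (fun z => L.weierstrassP (k + z)) (-h) := by
    have : AnalyticAt ℂ L.weierstrassP (k + -h) :=
      L.analyticOnNhd_weierstrassP _ (by simpa [sub_eq_add_neg] using hkh)
    exact this.comp (f := fun z => k + z) (x := -h) (by fun_prop)
  have hcong2 : L.weierstrassP =ᶠ[𝓝[≠] (0 : ℂ)] fun z => L.weierstrassP (k - h + z) := by
    have ht : Tendsto (fun z : ℂ => -h + z) (𝓝[≠] 0) (𝓝[≠] (-h)) := by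
      refine tendsto_nhdsWithin_iff.mpr ⟨?_, ?_⟩
      · exact ((continuous_const.add continuous_id).tendsto' 0 (-h) (by simp)).mono_left
          nhdsWithin_le_nhds
      · filter_upwards [self_mem_nhdsWithin] with t ht
        simpa using ht
    filter_upwards [ht.eventually hcongr] with z hz
    have e1 : h + (-h + z) = z := by ring
    have e2 : k + (-h + z) = k - h + z := by ring
    rwa [e1, e2] at hz
  have han2 : AnalyticAt ℂ (fun z => L.weierstrassP (k - h + z)) 0 := by
    have : AnalyticAt ℂ L.weierstrassP (k - h + 0) :=
      L.analyticOnNhd_weierstrassP _ (by simpa using hkh)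
    exact this.comp (f := fun z => k - h + z) (x := 0) (by fun_prop)
  have h1 := L.order_weierstrassP 0 (zero_mem _)
  rw [meromorphicOrderAt_congr hcong2] at h1
  have h3 := han2.meromorphicOrderAt_nonneg
  rw [h1] at h3
  exact absurd h3 (by decide)

theorem discriminant_ne_zero (L : PeriodPair) : L.g₂ ^ 3 - 27 * L.g₃ ^ 2 ≠ 0 := by
  have mem : ∀ m n : ℤ, m * L.ω₁ + n * L.ω₂ ∈ L.lattice := fun m n => mem_lattice.mpr ⟨m, n, rfl⟩
  have n1 := L.ω₁_div_two_notMem_lattice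
  have n2 := L.ω₂_div_two_notMem_lattice
  have n3 : (L.ω₁ + L.ω₂) / 2 ∉ L.lattice := by
    have := (L.mul_ω₁_add_mul_ω₂_mem_lattice (α := 1 / 2) (β := 1 / 2)).not.mpr (by norm_num)
    convert this using 2
    push_cast; ring
  have n4 : L.ω₂ / 2 - L.ω₁ / 2 ∉ L.lattice := by
    have := (L.mul_ω₁_add_mul_ω₂_mem_lattice (α := -1 / 2) (β := 1 / 2)).not.mpr (by norm_num)
    convert this using 2
    push_cast; ring
  have m1 : 2 * (L.ω₁ / 2) ∈ L.lattice := by convert mem 1 0 using 1; push_cast; ring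
  have m2 : 2 * (L.ω₂ / 2) ∈ L.lattice := by convert mem 0 1 using 1; push_cast; ring
  have m3 : 2 * ((L.ω₁ + L.ω₂) / 2) ∈ L.lattice := by convert mem 1 1 using 1; push_cast; ring
  have d12 := L.weierstrassP_half_ne n1 n2 m1 m2 n4
  have d13 := L.weierstrassP_half_ne n1 n3 m1 m3 (by convert n2 using 2; ring)
  have d23 := L.weierstrassP_half_ne n2 n3 m2 m3 (by convert n1 using 2; ring)
  have r1 := L.derivWeierstrassP_sq _ n1
  have r2 := L.derivWeierstrassP_sq _ n2
  have r3 := L.derivWeierstrassP_sq _ n3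
  rw [L.derivWeierstrassP_half m1] at r1
  rw [L.derivWeierstrassP_half m2] at r2
  rw [L.derivWeierstrassP_half m3] at r3
  generalize L.weierstrassP (L.ω₁ / 2) = a at *
  generalize L.weierstrassP (L.ω₂ / 2) = b at *
  generalize L.weierstrassP ((L.ω₁ + L.ω₂) / 2) = c at *
  have s1 : L.g₂ = 4 * (a ^ 2 + a * b + b ^ 2) :=
    mul_left_cancel₀ (sub_ne_zero.mpr d12) (by linear_combination r1 - r2)
  have s2 : L.g₂ = 4 * (a ^ 2 + a * c + c ^ 2) :=
    mul_left_cancel₀ (sub_ne_zero.mpr d13) (by linear_combination r1 - r3)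
  have s3 : a + b + c = 0 :=
    mul_left_cancel₀ (sub_ne_zero.mpr d23) (by linear_combination (s2 - s1) / 4)
  have hc : c = -a - b := by linear_combination s3
  have hg3 : L.g₃ = 4 * a ^ 3 - L.g₂ * a := by linear_combination r1
  have : L.g₂ ^ 3 - 27 * L.g₃ ^ 2 = 16 * ((a - b) * (a - c) * (b - c)) ^ 2 := by
    rw [hg3, s1, hc]; ring
  rw [this]
  exact mul_ne_zero (by norm_num) (pow_ne_zero 2 (mul_ne_zero (mul_ne_zero (sub_ne_zero.mpr d12)
    (sub_ne_zero.mpr d13)) (sub_ne_zero.mpr d23)))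

/-- The Weierstrass model `y² = x³ - (g₂/4) x - g₃/4` of the torus `ℂ / L`; its points are
`(℘, ℘'/2)`, by the differential equation `℘'² = 4 ℘³ - g₂ ℘ - g₃`. -/
noncomputable def weierstrassModel (L : PeriodPair) : WeierstrassCurve ℂ where
  a₁ := 0
  a₂ := 0
  a₃ := 0
  a₄ := -L.g₂ / 4
  a₆ := -L.g₃ / 4

theorem weierstrassModel_discriminant (L : PeriodPair) :
    L.weierstrassModel.Δ = L.g₂ ^ 3 - 27 * L.g₃ ^ 2 := by
  simp only [weierstrassModel, WeierstrassCurve.Δ, WeierstrassCurve.b₂, WeierstrassCurve.b₄,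
    WeierstrassCurve.b₆, WeierstrassCurve.b₈]
  ring

instance instIsEllipticWeierstrassModel (L : PeriodPair) : L.weierstrassModel.IsElliptic where
  isUnit := by
    rw [weierstrassModel_discriminant]
    exact L.discriminant_ne_zero.isUnit

/-- The `j`-invariant of the torus `ℂ / L`. -/
noncomputable def jInvariant (L : PeriodPair) : ℂ := L.weierstrassModel.j

/-- The classical formula for the `j`-invariant of a lattice. -/
theorem jInvariant_eq (L : PeriodPair) :
    L.jInvariant = 1728 * L.g₂ ^ 3 / (L.g₂ ^ 3 - 27 * L.g₃ ^ 2) := by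
  have h := L.discriminant_ne_zero
  have hc : L.weierstrassModel.c₄ = 12 * L.g₂ := by
    simp only [weierstrassModel, WeierstrassCurve.c₄, WeierstrassCurve.b₂, WeierstrassCurve.b₄]
    ring
  rw [jInvariant, WeierstrassCurve.j, Units.val_inv_eq_inv_val, WeierstrassCurve.coe_Δ',
    weierstrassModel_discriminant, hc]
  field_simp
  ring

end PeriodPair

/-- A complex elliptic curve, seen as a complex Lie group: a compact connected complex manifold of
dimension one (charts in `ℂ`) with a commutative group law that is holomorphic. -/
class ComplexEllipticCurve (E : Type*) [TopologicalSpace E] [ChartedSpace ℂ E] [AddCommGroup E] :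
    Prop extends LieAddGroup 𝓘(ℂ) ω E, CompactSpace E, ConnectedSpace E, T2Space E

namespace ComplexEllipticCurve

section

variable (E F : Type*)
  [TopologicalSpace E] [ChartedSpace ℂ E] [AddCommGroup E] [ComplexEllipticCurve E]
  [TopologicalSpace F] [ChartedSpace ℂ F] [AddCommGroup F] [ComplexEllipticCurve F]

/-- `Hom(E, F)`: the `ℤ`-module of holomorphic group homomorphisms `E → F`. -/
def Hom : Submodule ℤ (E →+ F) := AddSubgroup.toIntSubmodule
  { carrier := {f | MDifferentiable 𝓘(ℂ) 𝓘(ℂ) f}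
    zero_mem' := mdifferentiable_const
    add_mem' := by
      intro f g hf hg
      have hadd : MDifferentiable (𝓘(ℂ).prod 𝓘(ℂ)) 𝓘(ℂ) fun p : F × F => p.1 + p.2 :=
        (contMDiff_add 𝓘(ℂ) ω).mdifferentiable (by simp)
      exact hadd.comp (hf.prodMk hg)
    neg_mem' := by
      intro f hf
      have hneg : MDifferentiable 𝓘(ℂ) 𝓘(ℂ) fun p : F => -p :=
        (contMDiff_neg 𝓘(ℂ) ω).mdifferentiable (by simp)
      exact hneg.comp hf }

variable {E F}

/-- An isogeny: a surjective holomorphic homomorphism with finite kernel. -/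
def IsIsogeny (f : E →+ F) : Prop :=
  f ∈ Hom E F ∧ Function.Surjective f ∧ (f.ker : Set E).Finite

/-- An automorphism: a holomorphic endomorphism with a holomorphic two-sided inverse. -/
def IsAutomorphism (f : AddMonoid.End E) : Prop :=
  f ∈ Hom E E ∧ ∃ g : AddMonoid.End E, g ∈ Hom E E ∧ f * g = 1 ∧ g * f = 1

variable (E F)

/-- Two elliptic curves are isogenous if there is an isogeny from one of them to the other. -/
def Isogenous : Prop :=
  (∃ f : E →+ F, IsIsogeny f) ∨ ∃ f : F →+ E, IsIsogeny f

/-- `E` has `j`-invariant `c`: there is an isomorphism of complex Lie groups `E ≅ ℂ / L`, with `L` a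
lattice of `j`-invariant `c`. The isomorphism is given as the composite `ℂ → ℂ / L ≅ E`, a
surjective holomorphic homomorphism with kernel `L`. -/
def HasJInvariant (c : ℂ) : Prop :=
  ∃ (L : PeriodPair) (π : ℂ →+ E), MDifferentiable 𝓘(ℂ) 𝓘(ℂ) π ∧ Function.Surjective π ∧
    π.ker = L.lattice.toAddSubgroup ∧ L.jInvariant = c

end

end ComplexEllipticCurve

/-!
Write `B = ℂ / L` through a uniformization `π : ℂ → B`. The theorem reduces to elementary geometry
of the plane once three facts are available.

*The lattice has the expected symmetry.* Let `ζ` have order `3` if `j(B) = 0`, so that `g₂ = 0`,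
and order `4` if `j(B) = 1728`, so that `g₃ = 0`. In both cases `ζ⁴ g₂ = g₂` and `ζ⁶ g₃ = g₃`, so
`ζ² ℘(ζ z)` solves the same differential equation `y'² = 4 y³ - g₂ y - g₃` as `℘`, with the same
principal part at `0`. Their difference is analytic at `0` and solves a linear singular equation
which excludes a leading term of any order `k ≥ 0` (`eventually_eq_zero_of_singular_ode`). Hence the
two functions agree, and so do their poles: `ζ L = L` (`PeriodPair.mul_mem_lattice_of_twist`). This
provides the automorphism of order `n`.

*Homomorphisms are multiplications.* A holomorphic homomorphism of connected one-dimensional complex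
Lie groups is trivial as soon as its derivative at the origin vanishes; otherwise it is a local
isomorphism, hence surjective with discrete kernel, and holomorphy descends along it. Matching
derivatives at the origin, every holomorphic homomorphism `ℂ → A` is `z ↦ q (c z)` for any fixed
nontrivial `q : ℂ → A` (`AddMonoidHom.exists_eq_comp_mul`); no covering theory is needed.
In particular an automorphism of `B` of order `n` is induced by a complex number `u` of order `n`.

*The curve `A` is uniformized through `B`.* An isogeny `A → B` has a dual, so in either case there
is a nontrivial `f : B → A`, and `q = f ∘ π` is a nontrivial homomorphism that kills `L`.

Now `Hom(B, A)` is identified with the group of multipliers `c` with `c L ⊆ ker q`. It is a closed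
discrete subgroup of `ℂ`, stable under multiplication by `u`. Since the open unit discs around the
points of `ℤ + ℤ u` cover the plane, division with remainder shows that it is generated by `c` and
`u c` for any nonzero element `c` of least absolute value
(`ComplexEllipticCurve.exists_isogeny_generating`). The homomorphism with multiplier `c` is `ψ`.
-/

/-! ### Holomorphic maps between one-dimensional complex manifolds -/

section Manifold

variable {X Y : Type*} [TopologicalSpace X] [ChartedSpace ℂ X] [IsManifold 𝓘(ℂ) 1 X]
  [TopologicalSpace Y] [ChartedSpace ℂ Y] [IsManifold 𝓘(ℂ) 1 Y]

theorem eventually_mdifferentiableAt_extChartAt_symm (x : X) :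
    ∀ᶠ z in 𝓝 (extChartAt 𝓘(ℂ) x x),
      MDifferentiableAt 𝓘(ℂ) 𝓘(ℂ) (extChartAt 𝓘(ℂ) x).symm z := by
  filter_upwards [eventually_mem_nhds_iff.mpr (extChartAt_target_mem_nhds (I := 𝓘(ℂ)) x)]
    with z hz
  exact (mdifferentiableOn_extChartAt_symm z (mem_of_mem_nhds hz)).mdifferentiableAt hz

omit [IsManifold 𝓘(ℂ) 1 X] in
theorem eventually_mdifferentiableAt_extChartAt_comp {f : X → Y}
    (hf : MDifferentiable 𝓘(ℂ) 𝓘(ℂ) f) (x : X) :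
    ∀ᶠ z in 𝓝 (extChartAt 𝓘(ℂ) x x), MDifferentiableAt 𝓘(ℂ) 𝓘(ℂ)
      (extChartAt 𝓘(ℂ) (f x)) (f ((extChartAt 𝓘(ℂ) x).symm z)) := by
  have hc : ContinuousAt (fun z => f ((extChartAt 𝓘(ℂ) x).symm z)) (extChartAt 𝓘(ℂ) x x) :=
    ContinuousAt.comp (g := f) (by simpa using (hf x).continuousAt)
      (continuousAt_extChartAt_symm (I := 𝓘(ℂ)) x)
  have hs := hc.preimage_mem_nhds (t := (chartAt ℂ (f x)).source) (by
    simpa using (chartAt ℂ (f x)).open_source.mem_nhds (mem_chart_source ℂ (f x)))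
  filter_upwards [hs] with z hz
  exact mdifferentiableAt_extChartAt hz

theorem eventually_differentiableAt_writtenInExtChartAt {f : X → Y}
    (hf : MDifferentiable 𝓘(ℂ) 𝓘(ℂ) f) (x : X) :
    ∀ᶠ z in 𝓝 (extChartAt 𝓘(ℂ) x x),
      DifferentiableAt ℂ (writtenInExtChartAt 𝓘(ℂ) 𝓘(ℂ) x f) z := by
  filter_upwards [eventually_mdifferentiableAt_extChartAt_symm x,
    eventually_mdifferentiableAt_extChartAt_comp hf x] with z h1 h2
  exact mdifferentiableAt_iff_differentiableAt.mp (h2.comp z ((hf _).comp z h1))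

/-- A holomorphic map whose derivative vanishes identically is locally constant. -/
theorem eventually_eq_of_mfderiv_eq_zero {f : X → Y} (hf : MDifferentiable 𝓘(ℂ) 𝓘(ℂ) f)
    (h0 : ∀ x, mfderiv 𝓘(ℂ) 𝓘(ℂ) f x = 0) (x : X) : ∀ᶠ y in 𝓝 x, f y = f x := by
  set φ := extChartAt 𝓘(ℂ) x
  set χ := extChartAt 𝓘(ℂ) (f x)
  set F := writtenInExtChartAt 𝓘(ℂ) 𝓘(ℂ) x f
  have hev : ∀ᶠ z in 𝓝 (φ x), DifferentiableAt ℂ F z ∧ fderiv ℂ F z = 0 := by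
    filter_upwards [eventually_mdifferentiableAt_extChartAt_symm x,
      eventually_mdifferentiableAt_extChartAt_comp hf x] with z h1 h2
    have hd := h2.comp z ((hf _).comp z h1)
    refine ⟨mdifferentiableAt_iff_differentiableAt.mp hd, ?_⟩
    rw [← mfderiv_eq_fderiv]
    refine (mfderiv_comp z h2 ((hf _).comp z h1)).trans ?_
    rw [mfderiv_comp z (hf _) h1, h0]
    exact (congrArg _ (ContinuousLinearMap.zero_comp _)).trans (ContinuousLinearMap.comp_zero _)
  obtain ⟨r, hr, hball⟩ := Metric.eventually_nhds_iff_ball.mp hev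
  have hconst : ∀ z ∈ Metric.ball (φ x) r, F z = F (φ x) := fun z hz =>
    Metric.isOpen_ball.is_const_of_fderiv_eq_zero (convex_ball (φ x) r).isPreconnected
      (fun w hw => (hball w hw).1.differentiableWithinAt) (fun w hw => (hball w hw).2) hz
      (Metric.mem_ball_self hr)
  filter_upwards [(continuousAt_extChartAt (I := 𝓘(ℂ)) x).preimage_mem_nhds
      (Metric.ball_mem_nhds _ hr), extChartAt_source_mem_nhds (I := 𝓘(ℂ)) x,
    (hf x).continuousAt.preimage_mem_nhds (extChartAt_source_mem_nhds (I := 𝓘(ℂ)) (f x))]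
    with y h1 h2 h3
  have := hconst (φ y) h1
  simp only [F, writtenInExtChartAt, Function.comp, φ, (extChartAt 𝓘(ℂ) x).left_inv h2,
    extChartAt_to_inv] at this
  exact (extChartAt 𝓘(ℂ) (f x)).injOn h3 (mem_extChartAt_source (f x)) this

/-- The holomorphic inverse function theorem: a holomorphic map with nonzero derivative at `x` has
a holomorphic local inverse there. -/
theorem exists_local_inverse {f : X → Y} (hf : MDifferentiable 𝓘(ℂ) 𝓘(ℂ) f) (x : X)
    (h0 : mfderiv 𝓘(ℂ) 𝓘(ℂ) f x ≠ 0) :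
    ∃ s : Y → X, MDifferentiableAt 𝓘(ℂ) 𝓘(ℂ) s (f x) ∧ s (f x) = x ∧
      (∀ᶠ y in 𝓝 (f x), f (s y) = y) ∧ ∀ᶠ z in 𝓝 x, s (f z) = z := by
  set φ := extChartAt 𝓘(ℂ) x with hφ
  set χ := extChartAt 𝓘(ℂ) (f x) with hχ
  set F := writtenInExtChartAt 𝓘(ℂ) 𝓘(ℂ) x f with hF
  have hFx : F (φ x) = χ (f x) := by simp [F, writtenInExtChartAt, φ, χ]
  have hd := eventually_differentiableAt_writtenInExtChartAt hf x
  have han : AnalyticAt ℂ F (φ x) := Complex.analyticAt_iff_eventually_differentiableAt.mpr hd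
  have hne : deriv F (φ x) ≠ 0 := by
    intro h
    apply h0
    have hz : fderiv ℂ F (φ x) = 0 := by
      ext
      simp [h]
    refine (hf x).mfderiv.trans ?_
    rw [modelWithCornersSelf_coe, Set.range_id, fderivWithin_univ]
    exact hz
  have hstrict : HasStrictDerivAt F (deriv F (φ x)) (φ x) := han.hasStrictDerivAt
  set G := hstrict.localInverse F _ _ hne with hG
  have hleft : ∀ᶠ z in 𝓝 (φ x), G (F z) = z :=
    HasStrictFDerivAt.eventually_left_inverse (hstrict.hasStrictFDerivAt_equiv hne)
  have hright : ∀ᶠ z in 𝓝 (F (φ x)), F (G z) = z :=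
    HasStrictFDerivAt.eventually_right_inverse (hstrict.hasStrictFDerivAt_equiv hne)
  have hGd : DifferentiableAt ℂ G (F (φ x)) :=
    (hstrict.to_localInverse hne).hasDerivAt.differentiableAt
  have hGx : G (F (φ x)) = φ x := hleft.self_of_nhds
  have hχc : ContinuousAt χ (f x) := continuousAt_extChartAt (I := 𝓘(ℂ)) (f x)
  have hφc : ContinuousAt φ x := continuousAt_extChartAt (I := 𝓘(ℂ)) x
  have hGχ : MDifferentiableAt 𝓘(ℂ) 𝓘(ℂ) (fun y => G (χ y)) (f x) := by
    have h1 : MDifferentiableAt 𝓘(ℂ) 𝓘(ℂ) G (χ (f x)) := by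
      rw [← hFx]; exact hGd.mdifferentiableAt
    exact h1.comp (f x) (mdifferentiableAt_extChartAt (mem_chart_source ℂ (f x)))
  have hGχx : G (χ (f x)) = φ x := by rw [← hFx, hGx]
  have hs : MDifferentiableAt 𝓘(ℂ) 𝓘(ℂ) (fun y => φ.symm (G (χ y))) (f x) := by
    have h1 : MDifferentiableAt 𝓘(ℂ) 𝓘(ℂ) φ.symm (G (χ (f x))) := by
      rw [hGχx]; exact (eventually_mdifferentiableAt_extChartAt_symm x).self_of_nhds
    exact h1.comp (f x) hGχ
  have hsx : φ.symm (G (χ (f x))) = x := by rw [hGχx]; simp [φ]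
  refine ⟨fun y => φ.symm (G (χ y)), hs, hsx, ?_, ?_⟩
  · have hfs : ContinuousAt (fun y => f (φ.symm (G (χ y)))) (f x) :=
      ContinuousAt.comp (g := f) (by rw [hsx]; exact (hf x).continuousAt) hs.continuousAt
    have hmem := hfs.preimage_mem_nhds (t := χ.source) (by
      rw [hsx]; exact extChartAt_source_mem_nhds (I := 𝓘(ℂ)) (f x))
    rw [hFx] at hright
    filter_upwards [hχc.eventually hright, hmem, extChartAt_source_mem_nhds (I := 𝓘(ℂ)) (f x)]
      with y h1 h2 h3
    exact χ.injOn h2 h3 h1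
  · have hmem := (hf x).continuousAt.preimage_mem_nhds
      (extChartAt_source_mem_nhds (I := 𝓘(ℂ)) (f x))
    filter_upwards [hφc.eventually hleft, extChartAt_source_mem_nhds (I := 𝓘(ℂ)) x] with z h1 h2
    have hz : φ.symm (φ z) = z := φ.left_inv h2
    have : F (φ z) = χ (f z) := by
      change χ (f (φ.symm (φ z))) = χ (f z)
      rw [hz]
    change φ.symm (G (χ (f z))) = z
    rw [← this, h1, hz]

end Manifold

/-! ### Holomorphic homomorphisms between one-dimensional complex Lie groups -/

theorem AddSubgroup.eq_top_of_mem_nhds_zero {G : Type*} [AddGroup G] [TopologicalSpace G]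
    [IsTopologicalAddGroup G] [PreconnectedSpace G] {H : AddSubgroup G}
    (h : (H : Set G) ∈ 𝓝 0) : H = ⊤ := by
  have ho := H.isOpen_of_mem_nhds h
  exact SetLike.coe_injective (IsClopen.eq_univ ⟨H.isClosed_of_isOpen ho, ho⟩ ⟨0, H.zero_mem⟩)

section LieGroup

variable {X Y Z : Type*}
  [TopologicalSpace X] [ChartedSpace ℂ X] [AddCommGroup X] [LieAddGroup 𝓘(ℂ) ω X]
  [TopologicalSpace Y] [ChartedSpace ℂ Y] [AddCommGroup Y] [LieAddGroup 𝓘(ℂ) ω Y]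
  [TopologicalSpace Z] [ChartedSpace ℂ Z] [AddCommGroup Z] [LieAddGroup 𝓘(ℂ) ω Z]

theorem mdifferentiable_const_add (a : X) : MDifferentiable 𝓘(ℂ) 𝓘(ℂ) fun x : X => a + x :=
  (contMDiff_add_left (I := 𝓘(ℂ)) (n := ω)).mdifferentiable (by simp)

omit [TopologicalSpace X] [ChartedSpace ℂ X] [LieAddGroup 𝓘(ℂ) ω X] [TopologicalSpace Y]
  [ChartedSpace ℂ Y] [LieAddGroup 𝓘(ℂ) ω Y] in
/-- The behaviour of a homomorphism at any point is that at the origin, up to translations. -/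
theorem AddMonoidHom.eq_translate (p : X →+ Y) (x : X) :
    ⇑p = (fun y => p x + y) ∘ p ∘ fun y => -x + y := by
  ext y
  simp

/-- A homomorphism that is holomorphic at the origin is holomorphic. -/
theorem AddMonoidHom.mdifferentiable_of_zero (p : X →+ Y)
    (hp : MDifferentiableAt 𝓘(ℂ) 𝓘(ℂ) p 0) : MDifferentiable 𝓘(ℂ) 𝓘(ℂ) p := by
  intro x
  rw [p.eq_translate x]
  have h : MDifferentiableAt 𝓘(ℂ) 𝓘(ℂ) p (-x + x) := by rwa [neg_add_cancel]
  exact (mdifferentiable_const_add (p x) _).comp x (h.comp x (mdifferentiable_const_add (-x) x))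

/-- A holomorphic homomorphism with zero derivative at the origin is trivial: by translation its
derivative vanishes everywhere, so that its kernel is open. -/
theorem AddMonoidHom.eq_zero_of_mfderiv_eq_zero [ConnectedSpace X] {p : X →+ Y}
    (hp : MDifferentiable 𝓘(ℂ) 𝓘(ℂ) p) (h0 : mfderiv 𝓘(ℂ) 𝓘(ℂ) p 0 = 0) : p = 0 := by
  have hall : ∀ x, mfderiv 𝓘(ℂ) 𝓘(ℂ) p x = 0 := by
    intro x
    have h1 : mfderiv 𝓘(ℂ) 𝓘(ℂ) p (-x + x) = 0 := by rw [neg_add_cancel]; exact h0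
    have hx := mdifferentiable_const_add (-x) x
    have e : mfderiv 𝓘(ℂ) 𝓘(ℂ) ((fun y => p x + y) ∘ p ∘ fun y => -x + y) x = 0 := by
      rw [mfderiv_comp x (mdifferentiable_const_add (p x) _) ((hp _).comp x hx),
        mfderiv_comp x (hp _) hx, h1]
      exact (congrArg _ (ContinuousLinearMap.zero_comp _)).trans (ContinuousLinearMap.comp_zero _)
    rw [← p.eq_translate x] at e
    exact e
  have : IsTopologicalAddGroup X := topologicalAddGroup_of_lieAddGroup 𝓘(ℂ) ω
  have hker : p.ker = ⊤ := by
    refine AddSubgroup.eq_top_of_mem_nhds_zero ?_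
    filter_upwards [eventually_eq_of_mfderiv_eq_zero hp hall 0] with y hy
    rw [map_zero] at hy
    exact hy
  exact AddMonoidHom.ker_eq_top_iff.mp hker

/-- A nontrivial holomorphic homomorphism has a holomorphic local inverse at the origin. -/
theorem AddMonoidHom.exists_local_inverse [ConnectedSpace X] {p : X →+ Y}
    (hp : MDifferentiable 𝓘(ℂ) 𝓘(ℂ) p) (h0 : p ≠ 0) :
    ∃ s : Y → X, MDifferentiableAt 𝓘(ℂ) 𝓘(ℂ) s 0 ∧ s 0 = 0 ∧
      (∀ᶠ y in 𝓝 0, p (s y) = y) ∧ ∀ᶠ x in 𝓝 0, s (p x) = x := by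
  have := _root_.exists_local_inverse hp 0 fun h => h0 (eq_zero_of_mfderiv_eq_zero hp h)
  simpa only [map_zero] using this

theorem AddMonoidHom.surjective_of_ne_zero [ConnectedSpace X] [ConnectedSpace Y] {p : X →+ Y}
    (hp : MDifferentiable 𝓘(ℂ) 𝓘(ℂ) p) (h0 : p ≠ 0) : Function.Surjective p := by
  obtain ⟨s, -, -, hs, -⟩ := exists_local_inverse hp h0
  have : IsTopologicalAddGroup Y := topologicalAddGroup_of_lieAddGroup 𝓘(ℂ) ω
  rw [← AddMonoidHom.range_eq_top]
  refine AddSubgroup.eq_top_of_mem_nhds_zero ?_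
  filter_upwards [hs] with y hy using ⟨s y, hy⟩

/-- The kernel of a nontrivial holomorphic homomorphism is discrete. -/
theorem AddMonoidHom.eventually_eq_zero_of_map_eq_zero [ConnectedSpace X] {p : X →+ Y}
    (hp : MDifferentiable 𝓘(ℂ) 𝓘(ℂ) p) (h0 : p ≠ 0) : ∀ᶠ x in 𝓝 (0 : X), p x = 0 → x = 0 := by
  obtain ⟨s, -, hs0, -, hs⟩ := exists_local_inverse hp h0
  filter_upwards [hs] with x hx hpx
  rw [← hx, hpx, hs0]

theorem AddMonoidHom.finite_ker [ConnectedSpace X] [CompactSpace X] [T1Space Y] {p : X →+ Y}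
    (hp : MDifferentiable 𝓘(ℂ) 𝓘(ℂ) p) (h0 : p ≠ 0) : (p.ker : Set X).Finite := by
  have : IsTopologicalAddGroup X := topologicalAddGroup_of_lieAddGroup 𝓘(ℂ) ω
  have hcl : IsClosed (p.ker : Set X) := isClosed_singleton.preimage hp.continuous
  have hd : DiscreteTopology p.ker := by
    rw [discreteTopology_iff_isOpen_singleton_zero, isOpen_iff_eventually]
    rintro x rfl
    filter_upwards [continuousAt_subtype_val.eventually (eventually_eq_zero_of_map_eq_zero hp h0)]
      with y hy
    exact Subtype.ext (hy y.2)
  exact hcl.isCompact.finite ⟨hd⟩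

/-- Holomorphy descends along a nontrivial holomorphic homomorphism. -/
theorem AddMonoidHom.mdifferentiable_of_comp [ConnectedSpace X] {p : X →+ Y}
    (hp : MDifferentiable 𝓘(ℂ) 𝓘(ℂ) p) (h0 : p ≠ 0) {g : Y →+ Z}
    (hg : MDifferentiable 𝓘(ℂ) 𝓘(ℂ) (g.comp p)) : MDifferentiable 𝓘(ℂ) 𝓘(ℂ) g := by
  obtain ⟨s, hs, -, hps, -⟩ := exists_local_inverse hp h0
  refine g.mdifferentiable_of_zero (((hg _).comp 0 hs).congr_of_eventuallyEq ?_)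
  filter_upwards [hps] with y hy
  simp [hy]

omit [AddCommGroup X] [LieAddGroup 𝓘(ℂ) ω X] in
theorem mfderiv_add_apply_of_eq_zero {f g : X → Y} {x : X}
    (hf : MDifferentiableAt 𝓘(ℂ) 𝓘(ℂ) f x) (hg : MDifferentiableAt 𝓘(ℂ) 𝓘(ℂ) g x)
    (hfx : f x = 0) (hgx : g x = 0) {v a b : ℂ} (ha : (mfderiv 𝓘(ℂ) 𝓘(ℂ) f x v : ℂ) = a)
    (hb : (mfderiv 𝓘(ℂ) 𝓘(ℂ) g x v : ℂ) = b) :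
    (mfderiv 𝓘(ℂ) 𝓘(ℂ) (fun y => f y + g y) x v : ℂ) = a + b := by
  subst ha hb
  have hadd : MDifferentiable (𝓘(ℂ).prod 𝓘(ℂ)) 𝓘(ℂ) fun p : Y × Y => p.1 + p.2 :=
    (contMDiff_add 𝓘(ℂ) ω).mdifferentiable (by simp)
  have h1 := mfderiv_comp_apply x (hadd (f x, g x)) (hf.prodMk hg) v
  rw [mfderiv_prod_eq_add_apply (hadd _)] at h1
  refine h1.trans ?_
  rw [mfderiv_prodMk hf hg]
  have e1 : ∀ b y : Y, b = 0 → ∀ u : ℂ,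
      (mfderiv 𝓘(ℂ) 𝓘(ℂ) (fun z : Y => z + b) y u : ℂ) = u := by
    rintro b y rfl u
    have : (fun z : Y => z + 0) = id := by ext; simp
    rw [this, mfderiv_id]
    rfl
  have e2 : ∀ b y : Y, b = 0 → ∀ u : ℂ,
      (mfderiv 𝓘(ℂ) 𝓘(ℂ) (fun z : Y => b + z) y u : ℂ) = u := by
    rintro b y rfl u
    have : (fun z : Y => 0 + z) = id := by ext; simp
    rw [this, mfderiv_id]
    rfl
  exact congrArg₂ (fun s t : ℂ => s + t) (e1 _ _ hgx _) (e2 _ _ hfx _)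

/-- Up to rescaling, `ℂ` has only one nontrivial holomorphic homomorphism to a given
one-dimensional complex Lie group: match the derivatives at the origin. -/
theorem AddMonoidHom.exists_eq_comp_mul {p q : ℂ →+ Y} (hp : MDifferentiable 𝓘(ℂ) 𝓘(ℂ) p)
    (hq : MDifferentiable 𝓘(ℂ) 𝓘(ℂ) q) (hq0 : q ≠ 0) : ∃ c : ℂ, ∀ z, p z = q (c * z) := by
  set v : ℂ := mfderiv 𝓘(ℂ) 𝓘(ℂ) p 0 (1 : ℂ) with hv
  set w : ℂ := mfderiv 𝓘(ℂ) 𝓘(ℂ) q 0 (1 : ℂ) with hw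
  have hw0 : w ≠ 0 := by
    intro h
    refine hq0 (eq_zero_of_mfderiv_eq_zero hq ?_)
    exact ContinuousLinearMap.ext_ring h
  have hm : ∀ c : ℂ, MDifferentiableAt 𝓘(ℂ) 𝓘(ℂ) (fun z : ℂ => c * z) 0 := fun c =>
    mdifferentiableAt_iff_differentiableAt.mpr (by fun_prop)
  have hqc : ∀ c : ℂ, MDifferentiableAt 𝓘(ℂ) 𝓘(ℂ) (fun z : ℂ => q (c * z)) 0 := fun c =>
    (hq _).comp 0 (hm c)
  have hqd : ∀ c : ℂ, (mfderiv 𝓘(ℂ) 𝓘(ℂ) (fun z : ℂ => q (c * z)) 0 (1 : ℂ) : ℂ) = c * w := by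
    intro c
    have h1 := mfderiv_comp_apply (0 : ℂ) (hq (c * 0)) (hm c) (1 : ℂ)
    rw [mfderiv_eq_fderiv] at h1
    refine h1.trans ?_
    have h2 : fderiv ℂ (fun z : ℂ => c * z) 0 1 = c := by simp
    have h3 : ∀ y : ℂ, y = 0 → ∀ u : ℂ, (mfderiv 𝓘(ℂ) 𝓘(ℂ) q y u : ℂ) = u * w := by
      rintro y rfl u
      have h4 := (mfderiv 𝓘(ℂ) 𝓘(ℂ) q 0).map_smul u (1 : ℂ)
      rw [hw]
      refine Eq.trans (congrArg _ ?_) h4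
      exact (mul_one u).symm
    exact (h3 _ (mul_zero c) _).trans (congrArg (· * w) h2)
  refine ⟨v / w, fun z => ?_⟩
  let r : ℂ →+ Y := p + q.comp (AddMonoidHom.mulLeft (-(v / w)))
  have hr : r = 0 := by
    have hadd : MDifferentiable (𝓘(ℂ).prod 𝓘(ℂ)) 𝓘(ℂ) fun p : Y × Y => p.1 + p.2 :=
      (contMDiff_add 𝓘(ℂ) ω).mdifferentiable (by simp)
    refine eq_zero_of_mfderiv_eq_zero (r.mdifferentiable_of_zero ?_) ?_
    · exact (hadd _).comp 0 ((hp 0).prodMk (hqc _))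
    · refine ContinuousLinearMap.ext_ring ?_
      refine (mfderiv_add_apply_of_eq_zero (hp 0) (hqc (-(v / w))) (map_zero p) (by simp) hv.symm
        (hqd _)).trans ?_
      change v + -(v / w) * w = 0
      rw [neg_mul, div_mul_cancel₀ v hw0, add_neg_cancel]
  have := DFunLike.congr_fun hr z
  simp only [r, AddMonoidHom.add_apply, AddMonoidHom.comp_apply, AddMonoidHom.coe_mulLeft,
    neg_mul, map_neg, AddMonoidHom.zero_apply] at this
  exact add_neg_eq_zero.mp this

end LieGroup

/-! ### Extra symmetries of a lattice with `g₂ = 0` or `g₃ = 0` -/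

/-- A function that is analytic at `0`, and satisfies near `0` a linear first-order equation
`P y' = Q y` with `x³ P → -4` and `x⁴ Q → 12`, vanishes near `0`: the exponent `k` of its leading
term would satisfy `-4 k = 12`. -/
theorem eventually_eq_zero_of_singular_ode {y P Q : ℂ → ℂ} (hy : AnalyticAt ℂ y 0)
    (hP : Tendsto (fun x => x ^ 3 * P x) (𝓝[≠] 0) (𝓝 (-4)))
    (hQ : Tendsto (fun x => x ^ 4 * Q x) (𝓝[≠] 0) (𝓝 12))
    (hode : ∀ᶠ x in 𝓝[≠] 0, P x * deriv y x = Q x * y x) : ∀ᶠ x in 𝓝 0, y x = 0 := by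
  by_contra hne
  rw [← analyticOrderAt_eq_top] at hne
  obtain ⟨g, hg, hg0, hyg⟩ := hy.analyticOrderAt_ne_top.mp hne
  set k := analyticOrderNatAt y 0
  simp only [sub_zero, smul_eq_mul] at hyg
  have hder : ∀ᶠ x in 𝓝[≠] (0 : ℂ), deriv y x * x = x ^ k * (k * g x + x * deriv g x) := by
    filter_upwards [nhdsWithin_le_nhds hyg.eventuallyEq_nhds,
      nhdsWithin_le_nhds hg.eventually_analyticAt] with x hx hgx
    rw [hx.deriv_eq]
    have := (hasDerivAt_pow k x).mul hgx.differentiableAt.hasDerivAt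
    rw [show (fun z => z ^ k * g z) = (fun z => z ^ k) * g from rfl, this.deriv]
    rcases Nat.eq_zero_or_pos k with hk | hk
    · simp [hk]; ring
    · obtain ⟨m, hm⟩ := Nat.exists_eq_succ_of_ne_zero hk.ne'
      rw [hm]; simp [pow_succ]; ring
  have hgc : Tendsto g (𝓝[≠] 0) (𝓝 (g 0)) := hg.continuousAt.tendsto.mono_left nhdsWithin_le_nhds
  have hgd : Tendsto (deriv g) (𝓝[≠] 0) (𝓝 (deriv g 0)) :=
    hg.deriv.continuousAt.tendsto.mono_left nhdsWithin_le_nhds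
  have hid : Tendsto (fun x : ℂ => x) (𝓝[≠] 0) (𝓝 0) := tendsto_id.mono_left nhdsWithin_le_nhds
  have hlim1 : Tendsto (fun x => x ^ 3 * P x * (k * g x + x * deriv g x)) (𝓝[≠] 0)
      (𝓝 (-4 * (k * g 0 + 0 * deriv g 0))) :=
    hP.mul ((hgc.const_mul _).add (hid.mul hgd))
  have hlim2 : Tendsto (fun x => x ^ 4 * Q x * g x) (𝓝[≠] 0) (𝓝 (12 * g 0)) := hQ.mul hgc
  have heq : (fun x => x ^ 3 * P x * (k * g x + x * deriv g x)) =ᶠ[𝓝[≠] 0]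
      fun x => x ^ 4 * Q x * g x := by
    filter_upwards [hode, hder, nhdsWithin_le_nhds hyg, self_mem_nhdsWithin] with x h1 h2 h3 h4
    -- the equation, multiplied by `x⁴`, after cancelling the factor `xᵏ` of `y`
    refine mul_left_cancel₀ (pow_ne_zero k h4) ?_
    linear_combination -x ^ 3 * P x * h2 + x ^ 4 * h1 + x ^ 4 * Q x * h3
  have := tendsto_nhds_unique (hlim1.congr' heq) hlim2
  have hk : ((-4 * k : ℤ) : ℂ) = ((12 : ℤ) : ℂ) := by
    refine mul_right_cancel₀ hg0 ?_
    push_cast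
    linear_combination this
  have := Int.cast_injective hk
  omega

theorem tendsto_mul_nhdsNE_zero {c : ℂ} (hc : c ≠ 0) :
    Tendsto (fun z : ℂ => c * z) (𝓝[≠] 0) (𝓝[≠] 0) := by
  refine tendsto_nhdsWithin_iff.mpr ⟨?_, ?_⟩
  · exact ((continuous_const_mul c).tendsto' 0 0 (by simp)).mono_left nhdsWithin_le_nhds
  · filter_upwards [self_mem_nhdsWithin] with t ht using mul_ne_zero hc ht

namespace PeriodPair

variable (L : PeriodPair)

theorem eventually_notMem_lattice : ∀ᶠ z in 𝓝[≠] (0 : ℂ), z ∉ L.lattice := by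
  filter_upwards [nhdsWithin_le_nhds (L.compl_lattice_sdiff_singleton_mem_nhds 0),
    self_mem_nhdsWithin] with z hz hz' hl
  exact hz ⟨hl, hz'⟩

theorem tendsto_sq_mul_weierstrassP :
    Tendsto (fun z => z ^ 2 * L.weierstrassP z) (𝓝[≠] 0) (𝓝 1) := by
  have h : Tendsto (fun z => z ^ 2 * L.weierstrassPExcept 0 z + 1) (𝓝[≠] 0)
      (𝓝 (0 ^ 2 * L.weierstrassPExcept 0 0 + 1)) :=
    (((continuousAt_id.pow 2).mul (L.analyticAt_weierstrassPExcept 0).continuousAt).add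
      continuousAt_const).tendsto.mono_left nhdsWithin_le_nhds
  simp only [ne_eq, OfNat.ofNat_ne_zero, not_false_eq_true, zero_pow, zero_mul, zero_add] at h
  refine h.congr' ?_
  filter_upwards [self_mem_nhdsWithin] with z hz
  have hz : z ≠ 0 := hz
  have := L.weierstrassPExcept_def 0 z
  simp only [ZeroMemClass.coe_zero] at this
  rw [this]
  field_simp
  ring

theorem tendsto_pow_three_mul_derivWeierstrassP :
    Tendsto (fun z => z ^ 3 * L.derivWeierstrassP z) (𝓝[≠] 0) (𝓝 (-2)) := by
  have h : Tendsto (fun z => z ^ 3 * L.derivWeierstrassPExcept 0 z - 2) (𝓝[≠] 0)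
      (𝓝 (0 ^ 3 * L.derivWeierstrassPExcept 0 0 - 2)) :=
    (((continuousAt_id.pow 3).mul (L.analyticAt_derivWeierstrassPExcept 0).continuousAt).sub
      continuousAt_const).tendsto.mono_left nhdsWithin_le_nhds
  simp only [ne_eq, OfNat.ofNat_ne_zero, not_false_eq_true, zero_pow, zero_mul, zero_sub] at h
  refine h.congr' ?_
  filter_upwards [self_mem_nhdsWithin] with z hz
  have hz : z ≠ 0 := hz
  have := L.derivWeierstrassPExcept_def 0 z
  simp only [ZeroMemClass.coe_zero] at this
  rw [this]
  field_simp
  ring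

variable {L}

/-- `℘` and its twist `ζ² ℘(ζ z)` solve the same first-order differential equation, as soon as `ζ`
preserves `g₂` and `g₃`, and they have the same principal part at `0`. -/
theorem eventually_weierstrassP_eq_twist {ζ : ℂ} (hζ : ζ ≠ 0) (h4 : ζ ^ 4 * L.g₂ = L.g₂)
    (h6 : ζ ^ 6 * L.g₃ = L.g₃) :
    ∀ᶠ z in 𝓝 0, L.weierstrassP z = ζ ^ 2 * L.weierstrassP (ζ * z) := by
  have htw := tendsto_mul_nhdsNE_zero hζ
  let y : ℂ → ℂ := fun z =>
    L.weierstrassPExcept 0 z - ζ ^ 2 * L.weierstrassPExcept 0 (ζ * z)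
  have hyan : AnalyticAt ℂ y 0 := by
    have h1 : AnalyticAt ℂ (L.weierstrassPExcept 0) (ζ * 0) := by
      rw [mul_zero]; exact L.analyticAt_weierstrassPExcept 0
    exact (L.analyticAt_weierstrassPExcept 0).sub
      (analyticAt_const.mul (h1.comp (f := fun z => ζ * z) (by fun_prop)))
  have hy : ∀ z, y z = L.weierstrassP z - ζ ^ 2 * L.weierstrassP (ζ * z) := by
    intro z
    have e1 := L.weierstrassPExcept_def 0 z
    have e2 := L.weierstrassPExcept_def 0 (ζ * z)
    simp only [ZeroMemClass.coe_zero] at e1 e2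
    simp only [y, e1, e2]
    rcases eq_or_ne z 0 with rfl | hz
    · simp
    · field_simp
      ring
  let P : ℂ → ℂ := fun z => L.derivWeierstrassP z + ζ ^ 3 * L.derivWeierstrassP (ζ * z)
  let Q : ℂ → ℂ := fun z => 4 * (L.weierstrassP z ^ 2
    + L.weierstrassP z * (ζ ^ 2 * L.weierstrassP (ζ * z))
    + (ζ ^ 2 * L.weierstrassP (ζ * z)) ^ 2) - L.g₂
  have hf := L.tendsto_sq_mul_weierstrassP
  have hh := hf.comp htw
  have hid : Tendsto (fun x : ℂ => x ^ 4 * L.g₂) (𝓝[≠] 0) (𝓝 0) :=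
    (Continuous.tendsto' (by fun_prop) 0 0 (by simp)).mono_left nhdsWithin_le_nhds
  have hP : Tendsto (fun x => x ^ 3 * P x) (𝓝[≠] 0) (𝓝 (-4)) := by
    have h1 := L.tendsto_pow_three_mul_derivWeierstrassP
    have := h1.add (h1.comp htw)
    norm_num at this
    refine this.congr fun x => ?_
    simp only [P]
    ring
  have hQ : Tendsto (fun x => x ^ 4 * Q x) (𝓝[≠] 0) (𝓝 12) := by
    have := ((((hf.pow 2).add (hf.mul hh)).add (hh.pow 2)).const_mul 4).sub hid
    norm_num at this
    refine this.congr fun x => ?_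
    simp only [Q]
    ring
  have hode : ∀ᶠ x in 𝓝[≠] 0, P x * deriv y x = Q x * y x := by
    filter_upwards [L.eventually_notMem_lattice, htw.eventually L.eventually_notMem_lattice]
      with x hx hζx
    have d : HasDerivAt y (L.derivWeierstrassP x
        - ζ ^ 2 * (L.derivWeierstrassP (ζ * x) * (ζ * 1))) x := by
      rw [funext hy]
      exact (L.hasDerivAt_weierstrassP' hx).sub
        (((L.hasDerivAt_weierstrassP' hζx).comp x ((hasDerivAt_id x).const_mul ζ)).const_mul (ζ ^ 2))
    rw [hy, d.deriv]
    have r1 := L.derivWeierstrassP_sq x hx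
    have r2 := L.derivWeierstrassP_sq (ζ * x) hζx
    simp only [P, Q]
    linear_combination r1 - ζ ^ 6 * r2 + ζ ^ 2 * L.weierstrassP (ζ * x) * h4 + h6
  filter_upwards [eventually_eq_zero_of_singular_ode hyan hP hQ hode] with z hz
  rw [hy] at hz
  exact sub_eq_zero.mp hz

/-- A lattice is the set of poles of its `℘`-function, so the symmetries of `℘` preserve it. -/
theorem mul_mem_lattice_of_twist {ζ : ℂ} (hζ : ζ ≠ 0) (h4 : ζ ^ 4 * L.g₂ = L.g₂)
    (h6 : ζ ^ 6 * L.g₃ = L.g₃) {l : ℂ} (hl : l ∈ L.lattice) : ζ * l ∈ L.lattice := by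
  by_contra hζl
  let D : ℂ → ℂ := fun z => L.weierstrassP z - ζ ^ 2 * L.weierstrassP (ζ * z)
  have htw : Meromorphic fun z => L.weierstrassP (ζ * z) := fun z =>
    MeromorphicAt.comp_analyticAt (f := L.weierstrassP) (g := fun z => ζ * z)
      (L.meromorphic_weierstrassP (ζ * z)) (by fun_prop)
  have hD : Meromorphic D := fun z =>
    (L.meromorphic_weierstrassP z).sub ((MeromorphicAt.const (ζ ^ 2) z).mul (htw z))
  have htop0 : meromorphicOrderAt D 0 = ⊤ := by
    rw [meromorphicOrderAt_eq_top_iff]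
    filter_upwards [nhdsWithin_le_nhds (eventually_weierstrassP_eq_twist hζ h4 h6)] with z hz
    exact sub_eq_zero.mpr hz
  have htop : meromorphicOrderAt D l = ⊤ := by
    by_contra hne
    exact (hD.exists_meromorphicOrderAt_ne_top_iff_forall.mp ⟨l, hne⟩) 0 htop0
  have hcongr : L.weierstrassP =ᶠ[𝓝[≠] l] fun z => ζ ^ 2 * L.weierstrassP (ζ * z) := by
    filter_upwards [meromorphicOrderAt_eq_top_iff.mp htop] with z hz using sub_eq_zero.mp hz
  have han : AnalyticAt ℂ (fun z => ζ ^ 2 * L.weierstrassP (ζ * z)) l :=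
    analyticAt_const.mul
      ((L.analyticOnNhd_weierstrassP _ hζl).comp (f := fun z => ζ * z) (by fun_prop))
  have h1 := L.order_weierstrassP l hl
  rw [meromorphicOrderAt_congr hcongr] at h1
  have h2 := han.meromorphicOrderAt_nonneg
  rw [h1] at h2
  exact absurd h2 (by decide)

theorem g₂_eq_zero_of_jInvariant (h : L.jInvariant = 0) : L.g₂ = 0 := by
  rw [jInvariant_eq, div_eq_zero_iff, or_iff_left L.discriminant_ne_zero] at h
  simpa using h

theorem g₃_eq_zero_of_jInvariant (h : L.jInvariant = 1728) : L.g₃ = 0 := by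
  rw [jInvariant_eq, div_eq_iff L.discriminant_ne_zero] at h
  have : L.g₃ ^ 2 = 0 := by linear_combination h / (1728 * 27)
  simpa using this

end PeriodPair

/-! ### Division with remainder in `ℤ[u]` for `u² + 1 = 0` or `u² + u + 1 = 0` -/

/-- The discs of radius one around the points of `ℤ + ℤ u` cover the plane. -/
theorem exists_norm_sub_add_mul_lt_one {u : ℂ} (hu : u ^ 2 + 1 = 0 ∨ u ^ 2 + u + 1 = 0) (w : ℂ) :
    ∃ a b : ℤ, ‖w - (a + b * u)‖ < 1 := by
  obtain ⟨him, hn, hr⟩ : u.im ≠ 0 ∧ u.re ^ 2 + u.im ^ 2 = 1 ∧ |u.re| ≤ 1 / 2 := by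
    rcases hu with hu | hu
    · have h1 := congrArg Complex.re hu
      have h2 := congrArg Complex.im hu
      simp [pow_two] at h1 h2
      have him : u.im ≠ 0 := fun h => by rw [h] at h1; nlinarith [sq_nonneg u.re]
      have hre : u.re = 0 := mul_right_cancel₀ him (by linarith)
      refine ⟨him, ?_, ?_⟩
      · rw [hre] at h1 ⊢; linarith
      · rw [hre]; norm_num
    · have h1 := congrArg Complex.re hu
      have h2 := congrArg Complex.im hu
      simp [pow_two] at h1 h2
      have him : u.im ≠ 0 := fun h => by rw [h] at h1; nlinarith [sq_nonneg (u.re + 1 / 2)]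
      have hre : u.re = -1 / 2 := mul_right_cancel₀ him (by linarith)
      refine ⟨him, ?_, ?_⟩
      · rw [hre] at h1 ⊢; linarith
      · rw [hre]; norm_num [abs_le]
  -- the coordinates of `w` in the real basis `1, u`
  set y : ℝ := w.im / u.im with hy
  set x : ℝ := w.re - y * u.re with hx
  refine ⟨round x, round y, ?_⟩
  set s : ℝ := x - round x
  set t : ℝ := y - round y
  have hs : |s| ≤ 1 / 2 := abs_sub_round x
  have ht : |t| ≤ 1 / 2 := abs_sub_round y
  have hw : w - (round x + round y * u) = s + t * u := by
    have : w = x + y * u := by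
      apply Complex.ext
      · simp [hx]
      · simp [hy, div_mul_cancel₀ _ him]
    simp only [s, t]
    push_cast
    linear_combination this
  have hsq : ‖w - (round x + round y * u)‖ ^ 2 = s ^ 2 + t ^ 2 + 2 * (s * t * u.re) := by
    rw [hw, Complex.sq_norm, Complex.normSq_apply]
    simp
    linear_combination t ^ 2 * hn
  have hs2 : s ^ 2 ≤ (1 / 2) ^ 2 := sq_le_sq' (abs_le.mp hs).1 (abs_le.mp hs).2
  have ht2 : t ^ 2 ≤ (1 / 2) ^ 2 := sq_le_sq' (abs_le.mp ht).1 (abs_le.mp ht).2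
  have hst : s * t * u.re ≤ 1 / 2 * (1 / 2) * (1 / 2) := by
    refine (le_abs_self _).trans ?_
    rw [abs_mul, abs_mul]
    gcongr
  refine lt_of_pow_lt_pow_left₀ 2 zero_le_one ?_
  rw [hsq]
  linarith

theorem sq_add_one_eq_zero_of_orderOf {u : ℂ} (hu : orderOf u = 4) : u ^ 2 + 1 = 0 := by
  have h1 : u ^ 4 = 1 := hu ▸ pow_orderOf_eq_one u
  have h2 : u ^ 2 - 1 ≠ 0 := fun h => by
    have := orderOf_dvd_of_pow_eq_one (sub_eq_zero.mp h)
    rw [hu] at this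
    norm_num at this
  exact mul_left_cancel₀ h2 (by linear_combination h1)

theorem sq_add_self_add_one_eq_zero_of_orderOf {u : ℂ} (hu : orderOf u = 3) :
    u ^ 2 + u + 1 = 0 := by
  have h1 : u ^ 3 = 1 := hu ▸ pow_orderOf_eq_one u
  have h2 : u - 1 ≠ 0 := fun h => by
    rw [sub_eq_zero.mp h, orderOf_one] at hu
    norm_num at hu
  exact mul_left_cancel₀ h2 (by linear_combination h1)

/-! ### Homomorphisms of elliptic curves in terms of multipliers -/

namespace AddMonoidHom

variable {X Y : Type*} [TopologicalSpace X] [ChartedSpace ℂ X] [AddCommGroup X]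
  [TopologicalSpace Y] [ChartedSpace ℂ Y] [AddCommGroup Y]

theorem eq_zero_of_map_mul_eq_zero {G : Type*} [AddCommGroup G] {q : ℂ →+ G} (hq : q ≠ 0) {c : ℂ}
    (h : ∀ z, q (c * z) = 0) : c = 0 := by
  by_contra hc
  refine hq (AddMonoidHom.ext fun z => ?_)
  simpa [mul_div_cancel₀ z hc] using h (z / c)

theorem mdifferentiable_comp_mul {q : ℂ →+ Y} (hq : MDifferentiable 𝓘(ℂ) 𝓘(ℂ) q) (c : ℂ) :
    MDifferentiable 𝓘(ℂ) 𝓘(ℂ) (q.comp (AddMonoidHom.mulLeft c)) :=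
  hq.comp (mdifferentiable_iff_differentiable.mpr (by
    simpa using (differentiable_id (𝕜 := ℂ)).const_mul c))

/-- A holomorphic homomorphism that kills the kernel of a surjective one descends along it. -/
theorem exists_factor {Z : Type*} [TopologicalSpace Z] [ChartedSpace ℂ Z] [AddCommGroup Z]
    [LieAddGroup 𝓘(ℂ) ω X] [LieAddGroup 𝓘(ℂ) ω Y] [LieAddGroup 𝓘(ℂ) ω Z] [ConnectedSpace X]
    {p : X →+ Y} (hp : MDifferentiable 𝓘(ℂ) 𝓘(ℂ) p) (hp0 : p ≠ 0) (hs : Function.Surjective p)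
    {r : X →+ Z} (hr : MDifferentiable 𝓘(ℂ) 𝓘(ℂ) r) (hk : ∀ x, p x = 0 → r x = 0) :
    ∃ g : Y →+ Z, MDifferentiable 𝓘(ℂ) 𝓘(ℂ) g ∧ ∀ x, g (p x) = r x := by
  let g := p.liftOfSurjective hs ⟨r, hk⟩
  have hg : ∀ x, g (p x) = r x := p.liftOfRightInverse_comp_apply _ _ ⟨r, hk⟩
  refine ⟨g, mdifferentiable_of_comp hp hp0 ?_, hg⟩
  rwa [show g.comp p = r from AddMonoidHom.ext hg]

end AddMonoidHom

namespace ComplexEllipticCurve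

open AddMonoidHom

variable {A B : Type*}
  [TopologicalSpace A] [ChartedSpace ℂ A] [AddCommGroup A] [ComplexEllipticCurve A]
  [TopologicalSpace B] [ChartedSpace ℂ B] [AddCommGroup B] [ComplexEllipticCurve B]

theorem isIsogeny_of_ne_zero {f : A →+ B} (hf : MDifferentiable 𝓘(ℂ) 𝓘(ℂ) f) (h0 : f ≠ 0) :
    IsIsogeny f :=
  ⟨hf, surjective_of_ne_zero hf h0, finite_ker hf h0⟩

omit [TopologicalSpace B] [ChartedSpace ℂ B] [ComplexEllipticCurve B] in
/-- Under the dictionary `f ∘ π = π ∘ u` between endomorphisms and multipliers, orders agree. -/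
theorem orderOf_eq_of_multiplier {π : ℂ →+ B} (hπ0 : π ≠ 0) (hs : Function.Surjective π)
    {f : AddMonoid.End B} {u : ℂ} (hf : ∀ z, f (π z) = π (u * z)) : orderOf f = orderOf u := by
  have hpow : ∀ (k : ℕ) (z : ℂ), (f ^ k) (π z) = π (u ^ k * z) := by
    intro k
    induction k with
    | zero => simp
    | succ k ih =>
      intro z
      rw [pow_succ, pow_succ, mul_assoc, ← ih, ← hf]
      rfl
  rw [orderOf_eq_orderOf_iff]
  intro k
  constructor
  · intro h
    refine sub_eq_zero.mp (eq_zero_of_map_mul_eq_zero hπ0 fun z => ?_)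
    rw [sub_mul, one_mul, map_sub, ← hpow, h]
    exact sub_self (π z)
  · intro h
    refine DFunLike.ext (F := AddMonoid.End B) _ _ fun b => ?_
    obtain ⟨z, rfl⟩ := hs b
    rw [hpow, h, one_mul]
    rfl

/-- A multiplier of finite order that preserves the kernel of `π` induces an automorphism. -/
theorem exists_isAutomorphism {π : ℂ →+ B} (hπ : MDifferentiable 𝓘(ℂ) 𝓘(ℂ) π) (hπ0 : π ≠ 0)
    {u : ℂ} (hu : IsOfFinOrder u) (hk : ∀ z, π z = 0 → π (u * z) = 0) :
    ∃ f : AddMonoid.End B, IsAutomorphism f ∧ orderOf f = orderOf u := by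
  have hs := surjective_of_ne_zero hπ hπ0
  obtain ⟨f, hf, hfu⟩ := exists_factor hπ hπ0 hs (mdifferentiable_comp_mul hπ u) hk
  have hord : orderOf (G := AddMonoid.End B) f = orderOf u := orderOf_eq_of_multiplier hπ0 hs hfu
  let F : AddMonoid.End B := f
  have hpow : ∀ k : ℕ, F ^ k ∈ Hom B B := by
    intro k
    induction k with
    | zero => exact mdifferentiable_id
    | succ k ih =>
      rw [pow_succ']
      exact MDifferentiable.comp (g := F) hf ih
  obtain ⟨m, hm⟩ := Nat.exists_eq_succ_of_ne_zero hu.orderOf_pos.ne'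
  have h1 : F ^ (m + 1) = 1 := by
    rw [← Nat.succ_eq_add_one, ← hm, ← hord]
    exact pow_orderOf_eq_one F
  exact ⟨F, ⟨hf, F ^ m, hpow m, by rw [← pow_succ', h1], by rw [← pow_succ, h1]⟩, hord⟩

/-- The multipliers `c` with `c (ker π) ⊆ ker q`: they correspond to the homomorphisms `B → A`
when `π : ℂ → B` and `q : ℂ → A` are uniformizations. -/
def multipliers (π : ℂ →+ B) (q : ℂ →+ A) : AddSubgroup ℂ where
  carrier := {c | ∀ l, π l = 0 → q (c * l) = 0}
  zero_mem' := fun l _ => by simp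
  add_mem' := fun ha hb l hl => by rw [add_mul, map_add, ha l hl, hb l hl, add_zero]
  neg_mem' := fun ha l hl => by rw [neg_mul, map_neg, ha l hl, neg_zero]

omit [TopologicalSpace B] [ChartedSpace ℂ B] [ComplexEllipticCurve B] in
/-- The multipliers form a discrete closed subgroup of `ℂ`, so that one of them has least nonzero
absolute value. -/
theorem exists_minimal_multiplier {π : ℂ →+ B} {q : ℂ →+ A} (hq : MDifferentiable 𝓘(ℂ) 𝓘(ℂ) q)
    (hq0 : q ≠ 0) {l₀ : ℂ} (hl₀ : l₀ ≠ 0) (hπl₀ : π l₀ = 0) {c₀ : ℂ}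
    (hc₀ : c₀ ∈ multipliers π q) (hc₀' : c₀ ≠ 0) :
    ∃ c ∈ multipliers π q, c ≠ 0 ∧ ∀ m ∈ multipliers π q, ‖m‖ < ‖c‖ → m = 0 := by
  have hclosed : IsClosed (multipliers π q : Set ℂ) := by
    have : (multipliers π q : Set ℂ) = ⋂ (l : ℂ) (_ : π l = 0), {c | q (c * l) = 0} := by
      ext c
      simp [multipliers]
    rw [this]
    exact isClosed_iInter fun l => isClosed_iInter fun _ =>
      isClosed_singleton.preimage (hq.continuous.comp (continuous_mul_const l))
  have hdisc : ∀ᶠ c in 𝓝 (0 : ℂ), c ∈ multipliers π q → c = 0 := by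
    have ht : Tendsto (fun c : ℂ => c * l₀) (𝓝 0) (𝓝 0) :=
      (continuous_mul_const l₀).tendsto' 0 0 (by simp)
    filter_upwards [ht.eventually (eventually_eq_zero_of_map_eq_zero hq hq0)] with c hc hcM
    exact (mul_eq_zero.mp (hc (hcM l₀ hπl₀))).resolve_right hl₀
  obtain ⟨r, hr, hball⟩ := Metric.eventually_nhds_iff_ball.mp hdisc
  have heq : {c | c ∈ multipliers π q ∧ c ≠ 0} = (multipliers π q : Set ℂ) ∩ (Metric.ball 0 r)ᶜ := by
    ext c
    refine and_congr_right fun hc => ⟨fun h0 hb => h0 (hball c hb hc), ?_⟩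
    rintro hb rfl
    exact hb (Metric.mem_ball_self hr)
  have hcl : IsClosed {c | c ∈ multipliers π q ∧ c ≠ 0} := by
    rw [heq]
    exact hclosed.inter Metric.isOpen_ball.isClosed_compl
  obtain ⟨c, ⟨hc, hc0⟩, hmin⟩ := hcl.exists_infDist_eq_dist ⟨c₀, hc₀, hc₀'⟩ 0
  refine ⟨c, hc, hc0, fun m hm hlt => ?_⟩
  by_contra hm0
  have := Metric.infDist_le_dist_of_mem (x := (0 : ℂ))
    (show m ∈ {c | c ∈ multipliers π q ∧ c ≠ 0} from ⟨hm, hm0⟩)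
  rw [hmin, dist_zero_left, dist_zero_left] at this
  exact absurd hlt this.not_gt

/-- The multipliers form a module over the norm-Euclidean ring `ℤ[u]`, generated by an element of
least nonzero absolute value; the corresponding homomorphism `ψ` generates `Hom(B, A)`. -/
theorem exists_isogeny_generating {π : ℂ →+ B} {q : ℂ →+ A}
    (hπ : MDifferentiable 𝓘(ℂ) 𝓘(ℂ) π) (hπ0 : π ≠ 0) (hq : MDifferentiable 𝓘(ℂ) 𝓘(ℂ) q)
    (hq0 : q ≠ 0) (hker : ∀ z, π z = 0 → q z = 0) {l₀ : ℂ} (hl₀ : l₀ ≠ 0) (hπl₀ : π l₀ = 0)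
    {u : ℂ} (hu : u ^ 2 + 1 = 0 ∨ u ^ 2 + u + 1 = 0) {lam : B →+ B} (hlam : lam ∈ Hom B B)
    (hlamu : ∀ z, lam (π z) = π (u * z)) :
    ∃ ψ : B →+ A, IsIsogeny ψ ∧ Hom B A = Submodule.span ℤ {ψ, ψ.comp lam} := by
  have hs := surjective_of_ne_zero hπ hπ0
  obtain ⟨c, hc, hc0, hmin⟩ := exists_minimal_multiplier (π := π) hq hq0 hl₀ hπl₀ (c₀ := 1)
    (fun l hl => by rw [one_mul, hker l hl]) one_ne_zero
  obtain ⟨ψ, hψ, hψc⟩ := exists_factor hπ hπ0 hs (mdifferentiable_comp_mul hq c) hc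
  simp only [comp_apply, coe_mulLeft] at hψc
  have hψ0 : ψ ≠ 0 := by
    rintro rfl
    exact hc0 (eq_zero_of_map_mul_eq_zero hq0 fun z => (hψc z).symm)
  refine ⟨ψ, isIsogeny_of_ne_zero hψ hψ0, le_antisymm ?_ ?_⟩
  · intro φ hφ
    obtain ⟨m, hm⟩ := exists_eq_comp_mul (p := φ.comp π) (q := q)
      (MDifferentiable.comp (g := φ) hφ hπ) hq hq0
    simp only [comp_apply] at hm
    have hmM : m ∈ multipliers π q := fun l hl => by rw [← hm, hl, map_zero]
    have huc : u * c ∈ multipliers π q := fun l hl => by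
      rw [mul_comm u c, mul_assoc]
      exact hc _ (by rw [← hlamu, hl, map_zero])
    obtain ⟨a, b, hab⟩ := exists_norm_sub_add_mul_lt_one hu (m / c)
    -- the remainder of the division of `m` by `c` is a multiplier smaller than `c`
    have hrem : m - (a • c + b • (u * c)) = 0 := by
      refine hmin _ (sub_mem hmM (add_mem (zsmul_mem hc a) (zsmul_mem huc b))) ?_
      have : m - (a • c + b • (u * c)) = (m / c - (a + b * u)) * c := by
        simp only [zsmul_eq_mul]
        field_simp
      rw [this, norm_mul]
      exact mul_lt_of_lt_one_left (norm_pos_iff.mpr hc0) hab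
    refine Submodule.mem_span_pair.mpr ⟨a, b, AddMonoidHom.ext fun y => ?_⟩
    obtain ⟨z, rfl⟩ := hs y
    rw [hm, sub_eq_zero.mp hrem]
    simp only [AddMonoidHom.add_apply, AddMonoidHom.zsmul_apply, comp_apply, hlamu, hψc,
      ← map_zsmul, ← map_add]
    congr 1
    simp only [zsmul_eq_mul]
    ring
  · rw [Submodule.span_le]
    rintro φ (rfl | rfl)
    · exact hψ
    · exact MDifferentiable.comp (g := ψ) hψ hlam

omit [TopologicalSpace B] [ChartedSpace ℂ B] [ComplexEllipticCurve B] in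
/-- No positive integer annihilates `ℂ / L`: consider the image of `ω₁ / 2N`. -/
theorem exists_nsmul_ne_zero {L : PeriodPair} {π : ℂ →+ B} (hk : π.ker = L.lattice.toAddSubgroup)
    {N : ℕ} (hN : N ≠ 0) : ∃ b : B, N • b ≠ 0 := by
  refine ⟨π (L.ω₁ / 2 / N), fun h => ?_⟩
  rw [← map_nsmul, nsmul_eq_mul, mul_div_cancel₀ _ (Nat.cast_ne_zero.mpr hN)] at h
  have : L.ω₁ / 2 ∈ π.ker := h
  rw [hk] at this
  exact L.ω₁_div_two_notMem_lattice this

/-- An isogeny `f : A → B` has a dual `g : B → A`, determined by `g ∘ f = N` for `N = #ker f`; so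
isogenous curves admit a nontrivial homomorphism in the wanted direction. -/
theorem Isogenous.exists_hom_ne_zero (hAB : Isogenous A B)
    (htors : ∀ N : ℕ, N ≠ 0 → ∃ b : B, N • b ≠ 0) :
    ∃ f : B →+ A, MDifferentiable 𝓘(ℂ) 𝓘(ℂ) f ∧ f ≠ 0 := by
  rcases hAB with ⟨f, hf, hs, hfin⟩ | ⟨f, hf, -, hfin⟩
  · have : Finite f.ker := hfin
    obtain ⟨b, hb⟩ := htors _ (Nat.card_pos (α := f.ker)).ne'
    have hf0 : f ≠ 0 := by
      rintro rfl
      obtain ⟨a, rfl⟩ := hs b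
      simp at hb
    obtain ⟨g, hg, hgf⟩ := exists_factor (r := Nat.card f.ker • AddMonoidHom.id A) hf hf0 hs
      ((Hom A A).nsmul_mem (mdifferentiable_id : AddMonoidHom.id A ∈ Hom A A) _) (fun x hx =>
        congrArg Subtype.val (card_nsmul_eq_zero' (x := (⟨x, hx⟩ : f.ker))))
    refine ⟨g, hg, ?_⟩
    rintro rfl
    obtain ⟨a, rfl⟩ := hs b
    apply hb
    rw [← map_nsmul]
    have := (hgf a).symm
    simp only [AddMonoidHom.nsmul_apply, AddMonoidHom.id_apply, AddMonoidHom.zero_apply] at this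
    rw [this, map_zero]
  · refine ⟨f, hf, ?_⟩
    rintro rfl
    have hfin' : Finite B := by
      rw [ker_zero] at hfin
      exact Set.finite_univ_iff.mp hfin
    obtain ⟨b, hb⟩ := htors _ (Nat.card_pos (α := B)).ne'
    exact hb card_nsmul_eq_zero'

end ComplexEllipticCurve

/-- The identities `u⁴ g₂ = g₂` and `u⁶ g₃ = g₃` hold because one of `g₂`, `g₃` vanishes and `u` has
order `3` or `4`. -/
theorem PeriodPair.mul_mem_lattice_of_orderOf {L : PeriodPair} {n : ℕ}
    (h : (L.jInvariant = 0 ∧ n = 3) ∨ (L.jInvariant = 1728 ∧ n = 4)) {u : ℂ} (hu : orderOf u = n)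
    {l : ℂ} (hl : l ∈ L.lattice) : u * l ∈ L.lattice := by
  have hun : u ^ n = 1 := hu ▸ pow_orderOf_eq_one u
  rcases h with ⟨hj, rfl⟩ | ⟨hj, rfl⟩
  · refine mul_mem_lattice_of_twist (by rintro rfl; simp at hun) ?_ ?_ hl
    · simp [g₂_eq_zero_of_jInvariant hj]
    · linear_combination (u ^ 3 + 1) * L.g₃ * hun
  · refine mul_mem_lattice_of_twist (by rintro rfl; simp at hun) ?_ ?_ hl
    · rw [hun, one_mul]
    · simp [g₃_eq_zero_of_jInvariant hj]

theorem mainTheorem10 {A B : Type*}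
    [TopologicalSpace A] [ChartedSpace ℂ A] [AddCommGroup A] [ComplexEllipticCurve A]
    [TopologicalSpace B] [ChartedSpace ℂ B] [AddCommGroup B] [ComplexEllipticCurve B]
    (hAB : ComplexEllipticCurve.Isogenous A B) (n : ℕ)
    (hB : (ComplexEllipticCurve.HasJInvariant B 0 ∧ n = 3) ∨
      (ComplexEllipticCurve.HasJInvariant B 1728 ∧ n = 4)) :
    (∃ lam : AddMonoid.End B, ComplexEllipticCurve.IsAutomorphism lam ∧ orderOf lam = n) ∧
    ∀ lam : AddMonoid.End B, ComplexEllipticCurve.IsAutomorphism lam → orderOf lam = n →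
      ∃ ψ : B →+ A, ComplexEllipticCurve.IsIsogeny ψ ∧
        ComplexEllipticCurve.Hom B A = Submodule.span ℤ {ψ, ψ.comp lam} := by
  obtain ⟨L, π, hπ, hs, hk, hj⟩ : ∃ (L : PeriodPair) (π : ℂ →+ B), MDifferentiable 𝓘(ℂ) 𝓘(ℂ) π ∧
      Function.Surjective π ∧ π.ker = L.lattice.toAddSubgroup ∧
      ((L.jInvariant = 0 ∧ n = 3) ∨ (L.jInvariant = 1728 ∧ n = 4)) := by
    rcases hB with ⟨⟨L, π, hπ, hs, hk, hj⟩, hn⟩ | ⟨⟨L, π, hπ, hs, hk, hj⟩, hn⟩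
    · exact ⟨L, π, hπ, hs, hk, Or.inl ⟨hj, hn⟩⟩
    · exact ⟨L, π, hπ, hs, hk, Or.inr ⟨hj, hn⟩⟩
  have hmem : ∀ z, π z = 0 ↔ z ∈ L.lattice := fun z => by
    rw [← AddMonoidHom.mem_ker, hk]
    rfl
  have hπ0 : π ≠ 0 := by
    rintro rfl
    exact L.ω₁_div_two_notMem_lattice ((hmem _).mp rfl)
  have hω : L.ω₁ ≠ 0 := fun h => L.ω₁_div_two_notMem_lattice (by simp [h])
  have hn0 : n ≠ 0 := by rcases hj with ⟨-, rfl⟩ | ⟨-, rfl⟩ <;> norm_num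
  constructor
  · have hζ := (Complex.isPrimitiveRoot_exp n hn0).eq_orderOf
    set ζ := Complex.exp (2 * Real.pi * Complex.I / n)
    have hfin : IsOfFinOrder ζ := orderOf_pos_iff.mp (hζ ▸ Nat.pos_of_ne_zero hn0)
    obtain ⟨f, hf, hord⟩ := ComplexEllipticCurve.exists_isAutomorphism hπ hπ0 hfin fun z hz =>
      (hmem _).mpr (PeriodPair.mul_mem_lattice_of_orderOf hj hζ.symm ((hmem z).mp hz))
    exact ⟨f, hf, hord.trans hζ.symm⟩
  · intro lam hlam hord
    obtain ⟨f, hf, hf0⟩ := hAB.exists_hom_ne_zero fun N hN =>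
      ComplexEllipticCurve.exists_nsmul_ne_zero hk hN
    obtain ⟨u, hu⟩ := AddMonoidHom.exists_eq_comp_mul (p := AddMonoidHom.comp lam π) (q := π)
      (MDifferentiable.comp (g := lam) hlam.1 hπ) hπ hπ0
    have hou : orderOf u = n := by
      rw [← hord]
      exact (ComplexEllipticCurve.orderOf_eq_of_multiplier hπ0 hs hu).symm
    have hquad : u ^ 2 + 1 = 0 ∨ u ^ 2 + u + 1 = 0 := by
      rcases hj with ⟨-, rfl⟩ | ⟨-, rfl⟩
      · exact Or.inr (sq_add_self_add_one_eq_zero_of_orderOf hou)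
      · exact Or.inl (sq_add_one_eq_zero_of_orderOf hou)
    have hq0 : f.comp π ≠ 0 := by
      intro h
      refine hf0 (AddMonoidHom.ext fun b => ?_)
      obtain ⟨z, rfl⟩ := hs b
      exact DFunLike.congr_fun h z
    exact ComplexEllipticCurve.exists_isogeny_generating hπ hπ0
      (q := f.comp π) (MDifferentiable.comp (g := f) hf hπ) hq0
      (fun z hz => by rw [AddMonoidHom.comp_apply, hz, map_zero]) hω
      ((hmem _).mpr L.ω₁_mem_lattice) hquad hlam.1 hu
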